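/- Definitions. Let $\Omega$ be a finite set. A coherent configuration on $\Omega$ is a pair $\mathcal X=(\Omega,S)$, where $S$ is a partition of $\Omega\times\Omega$ (its elements are the basis relations of $\mathcal X$, and the unions of its elements are the relations of $\mathcal X$) such that the diagonal $1_\Omega$ is a relation, $s^*=\{(\beta,\alpha):(\alpha,\beta)\in s\}\in S$ for all $s\in S$, and for all $r,s,t\in S$ the number $c_{rs}^t=|\{\gamma:(\alpha,\gamma)\in r,\ (\gamma,\beta)\in s\}|$ does not depend on the choice of $(\alpha,\beta)\in t$. Coherent configurations on the same set are ordered by inclusion of their sets of relations; for every set of binary relations on $\Omega$ there is a smallest coherent configuration having them among its relations. For $A\subseteq\Omega$, the point extension $\mathcal X_A$ is the smallest coherent configuration that has all $s\in S$ and all $\{(\alpha,\alpha)\}$, $\alpha\in A$, among its relations. The set $A$ is a base of $\mathcal X$ if all basis relations of $\mathcal X_A$ are singletons, and the base number $b(\mathcal X)$ is the smallest cardinality of a base. An algebraic isomorphism from $\mathcal X=(\Omega,S)$ to a coherent configuration $\mathcal X'=(\Omega',S')$ is a bijection $\varphi:S\to S'$ with $c_{rs}^t=c_{\varphi(r)\varphi(s)}^{\varphi(t)}$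 for all $r,s,t\in S$; it extends to relations by taking unions. It is induced by an isomorphism if there is a bijection $f:\Omega\to\Omega'$ that takes $s$ to $\varphi(s)$ for every $s\in S$. Let $m\ge 1$. The $m$-extension of $\mathcal X$ is the smallest coherent configuration on $\Omega^m$ that has among its relations all the products $s_1\otimes\cdots\otimes s_m=\{(x,y):(x_i,y_i)\in s_i\text{ for all }i\}$ with $s_i\in S$, and the relation $1_\Delta=\{(x,x):x\in\Delta\}$, where $\Delta\subseteq\Omega^m$ is the set of constant tuples. The algebraic isomorphism $\varphi$ is $m$-dimensional if there is an algebraic isomorphism from the $m$-extension of $\mathcal X$ to the $m$-extension of $\mathcal X'$ that takes $s_1\otimes\cdots\otimes s_m$ to $\varphi(s_1)\otimes\cdots\otimes\varphi(s_m)$ for all $s_i\in S$, and $1_\Delta$ to $1_{\Delta'}$. The configuration $\mathcal X$ is $m$-separable if every $m$-dimensional algebraic isomorphism from $\mathcal X$ to a coherent configuration is induced by an isomorphism. Let $q$ be a prime power and $G=\mathrm{PSL}(2,q)$. Let $B$ and $N$ be the images in $G$ of the subgroups of upper triangular and of monomial matrices of $\mathrm{SL}(2,q)$, and let $H=B\cap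 N$ (the image of the diagonal subgroup). The Cartan scheme of $\mathrm{PSL}(2,q)$ is the coherent configuration on the set $\Omega$ of right cosets of $H$ in $G$ whose basis relations are the orbits of the coordinatewise action of $G$ on $\Omega\times\Omega$, where $G$ acts on $\Omega$ by right multiplications. (Equivalently, one can take $\mathrm{SL}(2,q)$ acting on the right cosets of its diagonal subgroup.) **Theorem.** Let $q>3$ be a prime power and let $\mathcal X$ be the Cartan scheme of $\mathrm{PSL}(2,q)$. Then $\mathcal X$ is $2$-separable and $b(\mathcal X)=2$. -/

import Mathlib

universe u v

/-! ## Coherent configurations -/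

/-- A coherent configuration on a finite set `Ω`: a partition `basis` of `Ω × Ω` such that the
diagonal is a union of classes, the partition is closed under `s ↦ s^*`, and for `r, s, t ∈ basis`
the number `|αr ∩ βs^*|` does not depend on the choice of `(α, β) ∈ t`. -/
structure CoherentConfiguration (Ω : Type u) [Finite Ω] where
  /-- the set `S` of basis relations -/
  basis : Set (Set (Ω × Ω))
  isPartition : Setoid.IsPartition basis
  diagonal_eq_sUnion : ∃ T ⊆ basis, ⋃₀ T = Set.diagonal Ω
  swap_mem : ∀ s ∈ basis, Prod.swap ⁻¹' s ∈ basis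
  coherent : ∀ r ∈ basis, ∀ s ∈ basis, ∀ t ∈ basis, ∀ p ∈ t, ∀ p' ∈ t,
    {γ : Ω | (p.1, γ) ∈ r ∧ (γ, p.2) ∈ s}.ncard = {γ : Ω | (p'.1, γ) ∈ r ∧ (γ, p'.2) ∈ s}.ncard

namespace CoherentConfiguration

section Basic

variable {Ω : Type u} [Finite Ω]

/-- The set `S^∪` of relations of `X`: all unions of basis relations. -/
def relations (X : CoherentConfiguration Ω) : Set (Set (Ω × Ω)) :=
  {R | ∃ T ⊆ X.basis, ⋃₀ T = R}

theorem nonempty_of_mem_basis (X : CoherentConfiguration Ω) {t : Set (Ω × Ω)}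
    (ht : t ∈ X.basis) : t.Nonempty :=
  Setoid.nonempty_of_mem_partition X.isPartition ht

/-- The intersection number `c_{rs}^t = |αr ∩ βs^*|`, where `(α, β)` is any element of `t`. -/
noncomputable def intersectionNumber (X : CoherentConfiguration Ω) (r s t : X.basis) : ℕ :=
  {γ : Ω | ((X.nonempty_of_mem_basis t.2).some.1, γ) ∈ r.1 ∧
    (γ, (X.nonempty_of_mem_basis t.2).some.2) ∈ s.1}.ncard

theorem intersectionNumber_eq (X : CoherentConfiguration Ω) (r s t : X.basis) {p : Ω × Ω}
    (hp : p ∈ t.1) :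
    X.intersectionNumber r s t = {γ : Ω | (p.1, γ) ∈ r.1 ∧ (γ, p.2) ∈ s.1}.ncard :=
  X.coherent r.1 r.2 s.1 s.2 t.1 t.2 _ (X.nonempty_of_mem_basis t.2).some_mem p hp

/-- `X` is complete if all its basis relations are singletons. -/
def IsComplete (X : CoherentConfiguration Ω) : Prop :=
  ∀ s ∈ X.basis, ∃ p, s = {p}

theorem mem_relations_iff (X : CoherentConfiguration Ω) {R : Set (Ω × Ω)} :
    R ∈ X.relations ↔ ∀ t ∈ X.basis, ∀ p ∈ t, ∀ p' ∈ t, p ∈ R → p' ∈ R := by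
  constructor
  · rintro ⟨T, hT, rfl⟩ t ht p hp p' hp' ⟨s, hs, hps⟩
    have : s = t := (X.isPartition.2 p).unique ⟨hT hs, hps⟩ ⟨ht, hp⟩
    exact ⟨s, hs, this ▸ hp'⟩
  · intro h
    refine ⟨{t ∈ X.basis | t ⊆ R}, fun t ht => ht.1, Set.Subset.antisymm ?_ ?_⟩
    · rintro p ⟨t, ht, hp⟩
      exact ht.2 hp
    · intro p hp
      obtain ⟨t, ⟨ht, hpt⟩, -⟩ := X.isPartition.2 p
      exact ⟨t, ⟨ht, fun p' hp' => h t ht p hpt p' hp' hp⟩, hpt⟩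

theorem ncard_eq_of_mem_relations (X : CoherentConfiguration Ω) {R S t : Set (Ω × Ω)}
    (hR : R ∈ X.relations) (hS : S ∈ X.relations) (ht : t ∈ X.basis) {p p' : Ω × Ω}
    (hp : p ∈ t) (hp' : p' ∈ t) :
    {γ : Ω | (p.1, γ) ∈ R ∧ (γ, p.2) ∈ S}.ncard =
      {γ : Ω | (p'.1, γ) ∈ R ∧ (γ, p'.2) ∈ S}.ncard := by
  classical
  have := Fintype.ofFinite Ω
  obtain ⟨T, hT, rfl⟩ := hR
  obtain ⟨T', hT', rfl⟩ := hS
  have key : ∀ q : Ω × Ω, {γ : Ω | (q.1, γ) ∈ ⋃₀ T ∧ (γ, q.2) ∈ ⋃₀ T'}.ncard =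
      ∑ x : T × T', {γ : Ω | (q.1, γ) ∈ x.1.1 ∧ (γ, q.2) ∈ x.2.1}.ncard := by
    intro q
    have hU : {γ : Ω | (q.1, γ) ∈ ⋃₀ T ∧ (γ, q.2) ∈ ⋃₀ T'} =
        ⋃ x ∈ (Finset.univ : Finset (T × T')),
          {γ : Ω | (q.1, γ) ∈ x.1.1 ∧ (γ, q.2) ∈ x.2.1} := by
      ext γ
      simp only [Set.mem_ofPred_eq, Set.mem_sUnion, Finset.mem_univ, Set.iUnion_true,
        Set.mem_iUnion, Prod.exists, Subtype.exists]
      constructor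
      · rintro ⟨⟨a, ha, h1⟩, b, hb, h2⟩
        exact ⟨a, ha, b, hb, h1, h2⟩
      · rintro ⟨a, ha, b, hb, h1, h2⟩
        exact ⟨⟨a, ha, h1⟩, b, hb, h2⟩
    have hU' : {γ : Ω | (q.1, γ) ∈ ⋃₀ T ∧ (γ, q.2) ∈ ⋃₀ T'} =
        ↑((Finset.univ : Finset (T × T')).biUnion fun x =>
          {γ : Ω | (q.1, γ) ∈ x.1.1 ∧ (γ, q.2) ∈ x.2.1}.toFinset) := by
      rw [hU]
      ext γ
      simp
    rw [hU', Set.ncard_coe_finset, Finset.card_biUnion]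
    · exact Finset.sum_congr rfl fun x _ => (Set.ncard_eq_toFinset_card' _).symm
    · intro x _ y _ hxy
      rw [Function.onFun, Finset.disjoint_left]
      intro γ h1 h2
      simp only [Set.mem_toFinset, Set.mem_ofPred_eq] at h1 h2
      apply hxy
      refine Prod.ext (Subtype.ext ?_) (Subtype.ext ?_)
      · exact (X.isPartition.2 _).unique ⟨hT x.1.2, h1.1⟩ ⟨hT y.1.2, h2.1⟩
      · exact (X.isPartition.2 _).unique ⟨hT' x.2.2, h1.2⟩ ⟨hT' y.2.2, h2.2⟩
  rw [key p, key p']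
  exact Finset.sum_congr rfl fun x _ =>
    X.coherent _ (hT x.1.2) _ (hT' x.2.2) t ht p hp p' hp'

/-- Two pairs are equivalent if they lie in the same relations common to all members of `F`. -/
def commonSetoid (F : Set (CoherentConfiguration Ω)) : Setoid (Ω × Ω) where
  r p q := ∀ R : Set (Ω × Ω), (∀ X ∈ F, R ∈ X.relations) → (p ∈ R ↔ q ∈ R)
  iseqv := ⟨fun _ _ _ => Iff.rfl, fun h R hR => (h R hR).symm,
    fun h h' R hR => (h R hR).trans (h' R hR)⟩

theorem mem_relations_of_commonSetoid (F : Set (CoherentConfiguration Ω)) {R : Set (Ω × Ω)}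
    (hR : ∀ p q, commonSetoid F p q → p ∈ R → q ∈ R) {X : CoherentConfiguration Ω}
    (hX : X ∈ F) : R ∈ X.relations := by
  rw [mem_relations_iff]
  intro t ht p hp p' hp' h
  refine hR p p' (fun Q hQ => ?_) h
  have := X.mem_relations_iff.1 (hQ X hX) t ht
  exact ⟨this p hp p' hp', this p' hp' p hp⟩

/-- The intersection of a family `F` of coherent configurations on `Ω`: the coherent configuration
whose set of relations is the intersection of the sets of relations of the members of `F`
(see `sInter_relations`). Its basis relations are the minimal nonempty common relations. -/
def sInter (F : Set (CoherentConfiguration Ω)) : CoherentConfiguration Ω where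
  basis := (commonSetoid F).classes
  isPartition := Setoid.isPartition_classes _
  diagonal_eq_sUnion := by
    refine ⟨{t ∈ (commonSetoid F).classes | t ⊆ Set.diagonal Ω}, fun t ht => ht.1,
      Set.Subset.antisymm (Set.sUnion_subset fun t ht => ht.2) fun p hp => ?_⟩
    refine ⟨{q | commonSetoid F q p}, ⟨Setoid.mem_classes _ p, fun q hq => ?_⟩, ?_⟩
    · exact (hq _ fun X _ => X.diagonal_eq_sUnion).2 hp
    · exact (commonSetoid F).refl p
  swap_mem := by
    have h : ∀ p q, commonSetoid F p q → commonSetoid F p.swap q.swap := by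
      intro p q hpq R hR
      refine hpq (Prod.swap ⁻¹' R) fun X hX => ?_
      obtain ⟨T, hT, rfl⟩ := hR X hX
      refine ⟨(fun s => Prod.swap ⁻¹' s) '' T, ?_, ?_⟩
      · rintro _ ⟨s, hs, rfl⟩
        exact X.swap_mem s (hT hs)
      · ext x
        simp
    rintro _ ⟨p, rfl⟩
    refine ⟨p.swap, Set.ext fun q => ⟨fun hq => ?_, fun hq => ?_⟩⟩
    · simpa using h _ _ hq
    · simpa using h _ _ hq
  coherent := by
    rintro _ ⟨a, rfl⟩ _ ⟨b, rfl⟩ _ ⟨c, rfl⟩ p hp p' hp'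
    have hpp : commonSetoid F p p' := (commonSetoid F).trans hp ((commonSetoid F).symm hp')
    refine ((hpp {q | {γ : Ω | (p.1, γ) ∈ {x | commonSetoid F x a} ∧
      (γ, p.2) ∈ {x | commonSetoid F x b}}.ncard = {γ : Ω | (q.1, γ) ∈ {x | commonSetoid F x a} ∧
      (γ, q.2) ∈ {x | commonSetoid F x b}}.ncard} fun X hX => ?_).1 rfl)
    have hcl : ∀ e : Ω × Ω, {x | commonSetoid F x e} ∈ X.relations := fun e =>
      mem_relations_of_commonSetoid F
        (fun x y hxy hx => (commonSetoid F).trans ((commonSetoid F).symm hxy) hx) hX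
    rw [mem_relations_iff]
    intro t ht q hq q' hq' h
    exact h.trans (X.ncard_eq_of_mem_relations (hcl a) (hcl b) ht hq hq')

theorem sInter_relations (F : Set (CoherentConfiguration Ω)) :
    (sInter F).relations = {R | ∀ X ∈ F, R ∈ X.relations} := by
  ext R
  constructor
  · intro hR X hX
    refine mem_relations_of_commonSetoid F (fun p q hpq hp => ?_) hX
    exact (sInter F).mem_relations_iff.1 hR {x | commonSetoid F x q} (Setoid.mem_classes _ q)
      p hpq q ((commonSetoid F).refl q) hp
  · intro hR
    rw [mem_relations_iff]
    rintro _ ⟨c, rfl⟩ p hp p' hp' h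
    exact (((commonSetoid F).trans hp ((commonSetoid F).symm hp')) R hR).1 h

/-- The smallest coherent configuration on `Ω` having all members of `K` among its relations. -/
def closure (K : Set (Set (Ω × Ω))) : CoherentConfiguration Ω :=
  sInter {Y | K ⊆ Y.relations}

/-- The point extension `X_{α, β, …}` with respect to the points `α, β, … ∈ A`: the smallest
coherent configuration that contains the basis relations of `X` and the relations
`1_α = {(α, α)}`, `α ∈ A`. -/
def pointExtension (X : CoherentConfiguration Ω) (A : Set Ω) : CoherentConfiguration Ω :=
  closure (X.basis ∪ {R | ∃ α ∈ A, R = {(α, α)}})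

/-- A set `A` of points is a base of `X` if the point extension with respect to `A` is complete. -/
def IsBase (X : CoherentConfiguration Ω) (A : Set Ω) : Prop :=
  (X.pointExtension A).IsComplete

/-- The base number `b(X)`: the smallest cardinality of a base. -/
noncomputable def baseNumber (X : CoherentConfiguration Ω) : ℕ :=
  sInf {n | ∃ A : Set Ω, X.IsBase A ∧ A.ncard = n}

end Basic

/-! ## Algebraic isomorphisms and separability -/

/-- An algebraic isomorphism: a bijection between the sets of basis relations preserving the
intersection numbers. -/
structure AlgebraicIso {Ω : Type u} {Ω' : Type v} [Finite Ω] [Finite Ω']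
    (X : CoherentConfiguration Ω) (X' : CoherentConfiguration Ω') where
  toEquiv : X.basis ≃ X'.basis
  intersectionNumber_eq : ∀ r s t, X.intersectionNumber r s t =
    X'.intersectionNumber (toEquiv r) (toEquiv s) (toEquiv t)

/-- The extension of an algebraic isomorphism `φ` to unions of basis relations: the union of a set
of basis relations is mapped to the union of their images. -/
def AlgebraicIso.mapRelation {Ω : Type u} {Ω' : Type v} [Finite Ω] [Finite Ω']
    {X : CoherentConfiguration Ω} {X' : CoherentConfiguration Ω'} (φ : AlgebraicIso X X')
    (R : Set (Ω × Ω)) : Set (Ω' × Ω') :=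
  ⋃ s : {s : X.basis // s.1 ⊆ R}, (φ.toEquiv s.1).1

/-- The algebraic isomorphism `φ` is induced by an isomorphism, i.e. `Iso(X, X', φ) ≠ ∅`: there is
a bijection `f : Ω → Ω'` with `s^f = φ(s)` for all basis relations `s` of `X`. -/
def AlgebraicIso.IsInduced {Ω : Type u} {Ω' : Type v} [Finite Ω] [Finite Ω']
    {X : CoherentConfiguration Ω} {X' : CoherentConfiguration Ω'} (φ : AlgebraicIso X X') : Prop :=
  ∃ f : Ω ≃ Ω', ∀ s : X.basis, Prod.map f f '' s.1 = (φ.toEquiv s).1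

/-- The relation `s_1 ⊗ ⋯ ⊗ s_m` on `Ω^m`, i.e. all `(x, y)` with `(x_i, y_i) ∈ s_i` for all `i`. -/
def tensorRelation {Ω : Type u} {m : ℕ} (s : Fin m → Set (Ω × Ω)) :
    Set ((Fin m → Ω) × (Fin m → Ω)) :=
  {p | ∀ i, (p.1 i, p.2 i) ∈ s i}

/-- The relation `1_Δ` on `Ω^m`, where `Δ = Diag(Ω^m)` is the set of all constant tuples. -/
def diagRelation (Ω : Type u) (m : ℕ) : Set ((Fin m → Ω) × (Fin m → Ω)) :=
  {p | p.1 = p.2 ∧ ∃ α : Ω, p.1 = fun _ => α}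

/-- The `m`-extension of `X`: the smallest coherent configuration on `Ω^m` that contains the
Cartesian `m`-power of `X` (whose basis relations are the `s_1 ⊗ ⋯ ⊗ s_m` with basis relations
`s_i` of `X`) and for which `Diag(Ω^m)` is a union of fibers. -/
def extension {Ω : Type u} [Finite Ω] (m : ℕ) (X : CoherentConfiguration Ω) :
    CoherentConfiguration (Fin m → Ω) :=
  closure ({R | ∃ s : Fin m → X.basis, R = tensorRelation fun i => (s i).1} ∪ {diagRelation Ω m})

/-- An algebraic isomorphism `φ : X → X'` is `m`-dimensional if it extends to the `m`-extensions:
there is an algebraic isomorphism between the `m`-extensions that coincides with `φ^m` on the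
Cartesian `m`-power of `X` and takes `1_Δ` to `1_{Δ'}`. -/
def AlgebraicIso.IsDimensional {Ω : Type u} {Ω' : Type v} [Finite Ω] [Finite Ω']
    {X : CoherentConfiguration Ω} {X' : CoherentConfiguration Ω'} (m : ℕ)
    (φ : AlgebraicIso X X') : Prop :=
  ∃ ψ : AlgebraicIso (X.extension m) (X'.extension m),
    (∀ s : Fin m → X.basis, ψ.mapRelation (tensorRelation fun i => (s i).1) =
      tensorRelation fun i => (φ.toEquiv (s i)).1) ∧
    ψ.mapRelation (diagRelation Ω m) = diagRelation Ω' m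

/-- `X` is `m`-separable if every `m`-dimensional algebraic isomorphism from `X` to a coherent
configuration is induced by an isomorphism. -/
def IsSeparable {Ω : Type u} [Finite Ω] (m : ℕ) (X : CoherentConfiguration Ω) : Prop :=
  ∀ (Ω' : Type u) [Finite Ω'] (X' : CoherentConfiguration Ω') (φ : AlgebraicIso X X'),
    φ.IsDimensional m → φ.IsInduced

/-! ## The coherent configuration of a group action -/

/-- The coherent configuration `Inv(G, Ω)`: its basis relations are the orbits of `G` acting
coordinatewise on `Ω × Ω`. -/
def ofAction (G : Type v) (Ω : Type u) [Group G] [Finite Ω] [MulAction G Ω] :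
    CoherentConfiguration Ω where
  basis := Set.range fun p : Ω × Ω => MulAction.orbit G p
  isPartition := by
    refine ⟨?_, fun p => ⟨MulAction.orbit G p, ⟨⟨p, rfl⟩, MulAction.mem_orbit_self p⟩, ?_⟩⟩
    · rintro ⟨p, hp⟩
      exact (MulAction.nonempty_orbit p).ne_empty hp
    · rintro _ ⟨⟨q, rfl⟩, hq⟩
      exact (MulAction.orbit_eq_iff.2 hq).symm
  diagonal_eq_sUnion := by
    refine ⟨Set.range fun α : Ω => MulAction.orbit G (α, α), ?_, Set.Subset.antisymm ?_ ?_⟩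
    · rintro _ ⟨α, rfl⟩
      exact ⟨(α, α), rfl⟩
    · rintro _ ⟨_, ⟨α, rfl⟩, g, rfl⟩
      simp
    · rintro ⟨α, β⟩ h
      obtain rfl : α = β := h
      exact ⟨_, ⟨α, rfl⟩, MulAction.mem_orbit_self _⟩
  swap_mem := by
    rintro _ ⟨p, rfl⟩
    refine ⟨p.swap, Set.ext fun q => ⟨?_, ?_⟩⟩
    · rintro ⟨g, rfl⟩
      exact ⟨g, rfl⟩
    · rintro ⟨g, hg⟩
      refine ⟨g, ?_⟩
      have := congrArg Prod.swap hg
      simpa using this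
  coherent := by
    have key : ∀ (a : Ω × Ω) (g : G) (x : Ω × Ω),
        g • x ∈ MulAction.orbit G a ↔ x ∈ MulAction.orbit G a := fun a g x => by
      rw [← MulAction.orbit_eq_iff, ← MulAction.orbit_eq_iff, MulAction.orbit_smul]
    rintro _ ⟨a, rfl⟩ _ ⟨b, rfl⟩ _ ⟨c, rfl⟩ p hp p' hp'
    have hpp : p' ∈ MulAction.orbit G p := by
      rw [MulAction.orbit_eq_iff.2 hp]
      exact hp'
    obtain ⟨g, rfl⟩ := hpp
    refine Set.ncard_congr (fun γ _ => g • γ) ?_ ?_ ?_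
    · rintro γ ⟨h1, h2⟩
      exact ⟨(key a g (p.1, γ)).2 h1, (key b g (γ, p.2)).2 h2⟩
    · intro γ γ' _ _ h
      exact smul_left_cancel g h
    · rintro γ ⟨h1, h2⟩
      refine ⟨g⁻¹ • γ, ⟨?_, ?_⟩, smul_inv_smul g γ⟩
      · rw [← key a g]
        simpa using h1
      · rw [← key b g]
        simpa using h2

end CoherentConfiguration

/-! ## Cartan schemes -/

/-- The set of right cosets `Hx` of a subgroup `H`. -/
def RightCosets {G : Type u} [Group G] (H : Subgroup G) : Type u :=
  Quotient (QuotientGroup.rightRel H)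

namespace RightCosets

variable {G : Type u} [Group G] (H : Subgroup G)

instance [Finite G] : Finite (RightCosets H) :=
  inferInstanceAs (Finite (Quotient (QuotientGroup.rightRel H)))

/-- The action of `G` on the right cosets by right multiplications, `(Hx) g = H(xg)`. -/
instance : MulAction Gᵐᵒᵖ (RightCosets H) where
  smul g := Quotient.map (fun x => x * g.unop) fun x y h => by
    have h' := QuotientGroup.rightRel_apply.1 h
    refine QuotientGroup.rightRel_apply.2 ?_
    simpa [mul_assoc] using h'
  one_smul := by
    rintro ⟨x⟩
    exact congrArg (Quotient.mk _) (mul_one x)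
  mul_smul := by
    rintro g h ⟨x⟩
    exact congrArg (Quotient.mk _) (mul_assoc x h.unop g.unop).symm

end RightCosets

/-- The Cartan scheme of a finite group `G` with respect to `(B, N)`: the coherent configuration of
`G` acting by right multiplications on the right cosets of the Cartan subgroup `H = B ∩ N`. -/
def cartanScheme {G : Type u} [Group G] [Finite G] (B N : Subgroup G) :
    CoherentConfiguration (RightCosets (B ⊓ N)) :=
  CoherentConfiguration.ofAction Gᵐᵒᵖ (RightCosets (B ⊓ N))

namespace PSL2

/-- The subgroup of upper triangular matrices in `SL(2, F)`. -/
def upperTriangular (F : Type u) [Field F] : Subgroup (Matrix.SpecialLinearGroup (Fin 2) F) where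
  carrier := {M | M 1 0 = 0}
  one_mem' := by simp
  mul_mem' := by
    intro M M' h h'
    simp only [Set.mem_ofPred_eq] at h h' ⊢
    simp [Matrix.mul_apply, Fin.sum_univ_two, h, h']
  inv_mem' := by
    intro M h
    simp only [Set.mem_ofPred_eq] at h ⊢
    simp [Matrix.adjugate_fin_two, h]

/-- The subgroup of monomial matrices in `SL(2, F)`. -/
def monomial (F : Type u) [Field F] : Subgroup (Matrix.SpecialLinearGroup (Fin 2) F) where
  carrier := {M | (M 0 1 = 0 ∧ M 1 0 = 0) ∨ (M 0 0 = 0 ∧ M 1 1 = 0)}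
  one_mem' := by simp
  mul_mem' := by
    intro M M' h h'
    simp only [Set.mem_ofPred_eq] at h h' ⊢
    rcases h with ⟨h1, h2⟩ | ⟨h1, h2⟩ <;> rcases h' with ⟨h3, h4⟩ | ⟨h3, h4⟩ <;>
      simp [Matrix.mul_apply, Fin.sum_univ_two, h1, h2, h3, h4]
  inv_mem' := by
    intro M h
    simp only [Set.mem_ofPred_eq] at h ⊢
    rcases h with ⟨h1, h2⟩ | ⟨h1, h2⟩ <;>
      simp [Matrix.adjugate_fin_two, h1, h2]

/-- The subgroup `B` of the standard `(B, N)`-pair of `PSL(2, F)`. -/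
def B (F : Type u) [Field F] : Subgroup (Matrix.ProjectiveSpecialLinearGroup (Fin 2) F) :=
  (upperTriangular F).map (QuotientGroup.mk' _)

/-- The subgroup `N` of the standard `(B, N)`-pair of `PSL(2, F)`. -/
def N (F : Type u) [Field F] : Subgroup (Matrix.ProjectiveSpecialLinearGroup (Fin 2) F) :=
  (monomial F).map (QuotientGroup.mk' _)

end PSL2

/-! Both claims rest on one property of a pair of points α, β: every point is reached from β by a
chain in which each new point is the only one with its basis relations to α and to the previous
point (`Determines`). In the extension at α and β, singleton fibers spread along such a chain, so
{α, β} is a base (`isBase_pair`). In the 2-extension the same induction shows that (α, γ) is the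
only pair in its relation to (α, β) (`eq_of_rel_extension_two_eq`). An algebraic isomorphism of
2-extensions transports this uniqueness, and the second coordinate of the image of (α, γ) defines
the required bijection (`isSeparable_two`). For the Cartan scheme take α = H and β = Hu with u upper
unipotent. The points in the same relation to α as Hy are the Hyg with g = diag(a, 1/a). The product
of the diagonal entries of xy⁻¹ is an invariant of the pair (Hx, Hy). Compared with u it yields a² =
1 if the first column of y has no zero; with the lower unipotent matrix it does so if the second has
none (`reflTransGen_determines`). One point is not enough: for q > 3 its stabilizer, a conjugate of
H, acts nontrivially (`two_le_ncard_of_isBase`). -/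

namespace CoherentConfiguration

/-! ### Basis relations of pairs, and coherence as a transport principle. -/

section Rel

variable {Ω : Type u} [Finite Ω] (X : CoherentConfiguration Ω)

/-- The basis relation containing the pair `(x, y)`. -/
noncomputable def rel (x y : Ω) : X.basis :=
  ⟨(X.isPartition.2 (x, y)).choose, (X.isPartition.2 (x, y)).choose_spec.1.1⟩

theorem mem_rel (x y : Ω) : (x, y) ∈ (X.rel x y).1 :=
  (X.isPartition.2 (x, y)).choose_spec.1.2

variable {X}

theorem rel_eq {x y : Ω} {s : X.basis} (h : (x, y) ∈ s.1) : X.rel x y = s :=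
  Subtype.ext ((X.isPartition.2 (x, y)).unique ⟨(X.rel x y).2, X.mem_rel x y⟩ ⟨s.2, h⟩)

theorem exists_rel_eq (s : X.basis) : ∃ x y, X.rel x y = s := by
  obtain ⟨p, hp⟩ := X.nonempty_of_mem_basis s.2
  exact ⟨p.1, p.2, rel_eq hp⟩

theorem mem_of_rel_eq {x y : Ω} {s : X.basis} (h : X.rel x y = s) : (x, y) ∈ s.1 :=
  h ▸ X.mem_rel x y

theorem mem_iff_of_rel_eq {x y x' y' : Ω} (h : X.rel x y = X.rel x' y') {R : Set (Ω × Ω)}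
    (hR : R ∈ X.relations) : (x, y) ∈ R ↔ (x', y') ∈ R := by
  have := X.mem_relations_iff.1 hR _ (X.rel x y).2
  exact ⟨this _ (X.mem_rel x y) _ (mem_of_rel_eq h.symm),
    this _ (mem_of_rel_eq h.symm) _ (X.mem_rel x y)⟩

theorem eq_of_rel_eq_rel_self {x y z : Ω} (h : X.rel y z = X.rel x x) : y = z :=
  (mem_iff_of_rel_eq h X.diagonal_eq_sUnion).2 rfl

theorem intersectionNumber_rel_ne_zero {r s : X.basis} {x y : Ω} :
    X.intersectionNumber r s (X.rel x y) ≠ 0 ↔ ∃ z, X.rel x z = r ∧ X.rel z y = s := by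
  rw [X.intersectionNumber_eq r s _ (X.mem_rel x y), ← Nat.pos_iff_ne_zero,
    Set.ncard_pos]
  exact ⟨fun ⟨z, h⟩ => ⟨z, rel_eq h.1, rel_eq h.2⟩,
    fun ⟨z, h⟩ => ⟨z, mem_of_rel_eq h.1, mem_of_rel_eq h.2⟩⟩

/-- Coherence is used mostly in this form: a positive intersection number stays positive, so a
triangle over one pair has a copy over any pair of the same basis relation. -/
theorem exists_rel_eq_rel {x y x' y' : Ω} (h : X.rel x y = X.rel x' y') (z : Ω) :
    ∃ z', X.rel x' z' = X.rel x z ∧ X.rel z' y' = X.rel z y :=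
  intersectionNumber_rel_ne_zero.1 (h ▸ intersectionNumber_rel_ne_zero.2 ⟨z, rfl, rfl⟩)

theorem rel_self_eq_of_rel_eq {x y x' y' : Ω} (h : X.rel x y = X.rel x' y') :
    X.rel y y = X.rel y' y' := by
  obtain ⟨z, -, hz⟩ := exists_rel_eq_rel h y
  obtain rfl := eq_of_rel_eq_rel_self hz
  exact hz.symm

/-- Over a fixed pair in `t`, each point is counted by exactly one pair of basis relations. Hence
intersection numbers determine the number of points. -/
theorem sum_intersectionNumber [Fintype X.basis] (t : X.basis) :
    ∑ p : X.basis × X.basis, X.intersectionNumber p.1 p.2 t = Nat.card Ω := by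
  classical
  have := Fintype.ofFinite Ω
  obtain ⟨x, y, rfl⟩ := exists_rel_eq t
  rw [Nat.card_eq_fintype_card, ← Finset.card_univ,
    Finset.card_eq_sum_card_fiberwise (f := fun z => (X.rel x z, X.rel z y))
      (t := Finset.univ) (fun _ _ => Finset.mem_coe.2 (Finset.mem_univ _))]
  refine Finset.sum_congr rfl fun p _ => ?_
  rw [X.intersectionNumber_eq _ _ _ (X.mem_rel x y), ← Set.ncard_coe_finset]
  congr 1
  ext z
  simp only [Set.mem_ofPred_eq, Finset.coe_filter, Finset.mem_univ, true_and, Prod.ext_iff]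
  exact ⟨fun h => ⟨rel_eq h.1, rel_eq h.2⟩, fun h => ⟨mem_of_rel_eq h.1, mem_of_rel_eq h.2⟩⟩

end Rel

/-! ### Determined points and bases. -/

section Relations

variable {Ω : Type u} [Finite Ω] {X : CoherentConfiguration Ω}

theorem mem_relations_iff_rel {R : Set (Ω × Ω)} :
    R ∈ X.relations ↔ ∀ x y x' y', X.rel x y = X.rel x' y' → (x, y) ∈ R → (x', y') ∈ R := by
  refine ⟨fun hR x y x' y' h => (mem_iff_of_rel_eq h hR).1, fun h => ?_⟩
  rw [mem_relations_iff]
  intro t ht p hp p' hp'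
  exact h _ _ _ _ ((rel_eq (s := ⟨t, ht⟩) hp).trans (rel_eq (s := ⟨t, ht⟩) hp').symm)

theorem basis_subset_relations : X.basis ⊆ X.relations := fun s hs =>
  ⟨{s}, Set.singleton_subset_iff.2 hs, Set.sUnion_singleton s⟩

theorem subset_relations_closure (K : Set (Set (Ω × Ω))) : K ⊆ (closure K).relations := by
  intro R hR
  rw [closure, sInter_relations]
  exact fun Y hY => hY hR

theorem relations_closure_subset {K : Set (Set (Ω × Ω))} {Y : CoherentConfiguration Ω}
    (h : K ⊆ Y.relations) : (closure K).relations ⊆ Y.relations := by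
  intro R hR
  rw [closure, sInter_relations] at hR
  exact hR Y h

/-- The point `γ` is determined by the basis relations of the pairs `(α, γ)` and `(ε, γ)`. -/
def Determines (X : CoherentConfiguration Ω) (α ε γ : Ω) : Prop :=
  ∀ δ, X.rel α δ = X.rel α γ → X.rel ε δ = X.rel ε γ → δ = γ

/-- The fibers of α and β in the point extension are singletons by construction, and a point
determined by two singleton fibers forms one too. -/
theorem isBase_pair {α β : Ω}
    (h : ∀ γ, Relation.ReflTransGen (X.Determines α) β γ) : X.IsBase {α, β} := by
  set Y := X.pointExtension {α, β}
  have hX : ∀ {x y x' y'}, Y.rel x y = Y.rel x' y' → X.rel x y = X.rel x' y' := by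
    intro x y x' y' hxy
    refine (rel_eq ((mem_iff_of_rel_eq hxy ?_).1 (X.mem_rel x y))).symm
    exact subset_relations_closure _ (Or.inl (X.rel x y).2)
  have hpt : ∀ ε ∈ ({α, β} : Set Ω), ∀ x, Y.rel x x = Y.rel ε ε → x = ε := by
    intro ε hε x hx
    have := (mem_iff_of_rel_eq hx (R := {(ε, ε)})
      (subset_relations_closure _ (Or.inr ⟨ε, hε, rfl⟩))).2 rfl
    exact congrArg Prod.fst this
  have key : ∀ γ x, Y.rel x x = Y.rel γ γ → x = γ := by
    intro γ
    induction h γ with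
    | refl => exact hpt β (by simp)
    | @tail ε γ _ hεγ ih =>
      intro x hx
      -- Transporting ω from γ to x within their common fiber gives a point in the fiber of ω, hence
      -- ω itself.
      have aux : ∀ ω, (∀ z, Y.rel z z = Y.rel ω ω → z = ω) → X.rel ω x = X.rel ω γ := by
        intro ω hω
        obtain ⟨z, hz, hz'⟩ := exists_rel_eq_rel hx.symm ω
        obtain ⟨w, hw, -⟩ := exists_rel_eq_rel hz'.symm ω
        obtain rfl := eq_of_rel_eq_rel_self hw
        obtain rfl := hω _ hw
        exact hX hz'
      exact hεγ x (aux α (hpt α (by simp))) (aux ε ih)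
  intro s hs
  obtain ⟨x, y, hxy⟩ := exists_rel_eq (X := Y) ⟨s, hs⟩
  refine ⟨(x, y), Set.eq_singleton_iff_unique_mem.2 ⟨mem_of_rel_eq hxy, ?_⟩⟩
  rintro ⟨x', y'⟩ h'
  have h1 : Y.rel x' y' = Y.rel x y := (rel_eq (s := ⟨s, hs⟩) h').trans hxy.symm
  obtain ⟨z, hz, -⟩ := exists_rel_eq_rel h1.symm x
  obtain rfl := eq_of_rel_eq_rel_self hz
  exact Prod.ext (key _ _ hz) (key _ _ (rel_self_eq_of_rel_eq h1))

end Relations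

/-! ### Transport along algebraic isomorphisms. -/

namespace AlgebraicIso

variable {Ω : Type u} {Ω' : Type v} [Finite Ω] [Finite Ω'] {X : CoherentConfiguration Ω}
  {X' : CoherentConfiguration Ω'}

/-- The inverse of an algebraic isomorphism. -/
def symm (φ : AlgebraicIso X X') : AlgebraicIso X' X where
  toEquiv := φ.toEquiv.symm
  intersectionNumber_eq r s t := by simp [φ.intersectionNumber_eq]

theorem exists_rel_eq_toEquiv (φ : AlgebraicIso X X') {x y : Ω} {x' y' : Ω'}
    (h : φ.toEquiv (X.rel x y) = X'.rel x' y') (z : Ω) :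
    ∃ z', X'.rel x' z' = φ.toEquiv (X.rel x z) ∧ X'.rel z' y' = φ.toEquiv (X.rel z y) := by
  rw [← intersectionNumber_rel_ne_zero, ← h, ← φ.intersectionNumber_eq]
  exact intersectionNumber_rel_ne_zero.2 ⟨z, rfl, rfl⟩

theorem exists_rel_eq_of_rel (φ : AlgebraicIso X X') {x y : Ω} {x' y' : Ω'}
    (h : φ.toEquiv (X.rel x y) = X'.rel x' y') (z' : Ω') :
    ∃ z, φ.toEquiv (X.rel x z) = X'.rel x' z' ∧ φ.toEquiv (X.rel z y) = X'.rel z' y' := by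
  obtain ⟨z, h1, h2⟩ := φ.symm.exists_rel_eq_toEquiv (x := x') (y := y') (x' := x) (y' := y)
    (by simp [symm, ← h]) z'
  exact ⟨z, by simp [h1, symm], by simp [h2, symm]⟩

theorem eq_of_toEquiv_rel_self (φ : AlgebraicIso X X') {x : Ω} {y z : Ω'}
    (h : φ.toEquiv (X.rel x x) = X'.rel y z) : y = z := by
  obtain ⟨w, hw, hw'⟩ := φ.exists_rel_eq_of_rel h z
  have hxw : x = w := eq_of_rel_eq_rel_self (φ.toEquiv.injective (hw.trans h.symm))
  subst hxw
  exact eq_of_rel_eq_rel_self (h.symm.trans hw')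

theorem eq_of_toEquiv_rel (φ : AlgebraicIso X X') {x y : Ω} {z : Ω'}
    (h : φ.toEquiv (X.rel x y) = X'.rel z z) : x = y :=
  φ.symm.eq_of_toEquiv_rel_self (x := z) (by simp [symm, ← h])

theorem card_eq [Nonempty Ω] (φ : AlgebraicIso X X') : Nat.card Ω = Nat.card Ω' := by
  have := Fintype.ofFinite X.basis
  have := Fintype.ofFinite X'.basis
  obtain ⟨x⟩ := ‹Nonempty Ω›
  rw [← sum_intersectionNumber (X.rel x x),
    ← sum_intersectionNumber (X := X') (φ.toEquiv (X.rel x x)),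
    ← (φ.toEquiv.prodCongr φ.toEquiv).sum_comp]
  exact Finset.sum_congr rfl fun p _ => φ.intersectionNumber_eq _ _ _

end AlgebraicIso

/-! ### The 2-extension and separability. -/

section Extension

variable {Ω : Type u} [Finite Ω] {X : CoherentConfiguration Ω} {m : ℕ}

theorem rel_apply_eq_of_rel_extension_eq {p q p' q' : Fin m → Ω}
    (h : (X.extension m).rel p q = (X.extension m).rel p' q') (i : Fin m) :
    X.rel (p i) (q i) = X.rel (p' i) (q' i) := by
  have hR : tensorRelation (fun i => (X.rel (p i) (q i)).1) ∈ (X.extension m).relations :=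
    subset_relations_closure _ (Or.inl ⟨fun i => X.rel (p i) (q i), rfl⟩)
  exact (rel_eq ((mem_iff_of_rel_eq h hR).1 (fun i => X.mem_rel _ _) i)).symm

/-- This is where 1_Δ enters: it lets the extension compare different coordinates of a tuple. -/
theorem exists_eq_const_of_rel_extension_eq {p : Fin m → Ω} {x : Ω}
    (h : (X.extension m).rel p p = (X.extension m).rel (fun _ => x) (fun _ => x)) :
    ∃ y, p = fun _ => y :=
  ((mem_iff_of_rel_eq h (R := diagRelation Ω m)
    (subset_relations_closure _ (Or.inr rfl))).2 ⟨rfl, x, rfl⟩).2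

theorem AlgebraicIso.rel_apply_eq_of_extension {Ω' : Type v} [Finite Ω']
    {X' : CoherentConfiguration Ω'} {φ : AlgebraicIso X X'}
    {ψ : AlgebraicIso (X.extension m) (X'.extension m)}
    (hψ : ∀ s : Fin m → X.basis, ψ.mapRelation (tensorRelation fun i => (s i).1) =
      tensorRelation fun i => (φ.toEquiv (s i)).1)
    {p q : Fin m → Ω} {p' q' : Fin m → Ω'}
    (h : ψ.toEquiv ((X.extension m).rel p q) = (X'.extension m).rel p' q') (i : Fin m) :
    φ.toEquiv (X.rel (p i) (q i)) = X'.rel (p' i) (q' i) := by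
  have hmem : (p', q') ∈ ψ.mapRelation (tensorRelation fun i => (X.rel (p i) (q i)).1) := by
    refine Set.mem_iUnion.2 ⟨⟨(X.extension m).rel p q, ?_⟩, h ▸ mem_rel _ _ _⟩
    rintro ⟨a, b⟩ hab j
    exact mem_of_rel_eq (rel_apply_eq_of_rel_extension_eq (rel_eq hab) j)
  rw [hψ fun i => X.rel (p i) (q i)] at hmem
  exact (rel_eq (hmem i)).symm

theorem eq_of_rel_extension_two_eq {α β γ : Ω}
    (h : Relation.ReflTransGen (X.Determines α) β γ) (Q : Fin 2 → Ω)
    (hQ : (X.extension 2).rel ![α, β] Q = (X.extension 2).rel ![α, β] ![α, γ]) :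
    Q = ![α, γ] := by
  induction h generalizing Q with
  | refl => exact (eq_of_rel_eq_rel_self hQ).symm
  | @tail ε γ _ hεγ ih =>
    obtain ⟨M, hM, hMQ⟩ := exists_rel_eq_rel hQ.symm ![α, ε]
    obtain rfl := ih M hM
    have h0 : α = Q 0 := eq_of_rel_eq_rel_self (rel_apply_eq_of_rel_extension_eq hMQ 0)
    have h1 : X.rel ε (Q 1) = X.rel ε γ := rel_apply_eq_of_rel_extension_eq hMQ 1
    -- The relation of α to the second coordinate of `Q` is read off from the constant pair (α, α).
    -- Its copy `N` over `Q` is again constant, and its first coordinate is α.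
    obtain ⟨N, -, hNQ⟩ :=
      exists_rel_eq_rel (rel_self_eq_of_rel_eq hMQ).symm (fun _ => α : Fin 2 → Ω)
    have hN0 : N 0 = Q 0 := eq_of_rel_eq_rel_self (rel_apply_eq_of_rel_extension_eq hNQ 0)
    have hN1 : X.rel (N 1) (Q 1) = X.rel α γ := rel_apply_eq_of_rel_extension_eq hNQ 1
    obtain ⟨P, hP, -⟩ := exists_rel_eq_rel hNQ.symm (fun _ => α : Fin 2 → Ω)
    obtain rfl := eq_of_rel_eq_rel_self hP
    obtain ⟨y, rfl⟩ := exists_eq_const_of_rel_extension_eq hP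
    have hy : y = α := hN0.trans h0.symm
    subst hy
    have := hεγ _ hN1 h1
    ext i
    fin_cases i
    · exact h0.symm
    · exact this

/-- A pair `P` in the image of the fiber of (α, β) replaces (α, β). Each (α, γ) then has exactly one
counterpart `F γ`, and the map γ ↦ `F γ 1` respects relations because second coordinates do. -/
theorem isSeparable_two {α β : Ω}
    (h : ∀ γ, Relation.ReflTransGen (X.Determines α) β γ) : X.IsSeparable 2 := by
  rintro Ω' _ X' φ ⟨ψ, hψ, -⟩
  have hne : Nonempty Ω := ⟨α⟩
  obtain ⟨P, P', hP⟩ := exists_rel_eq (ψ.toEquiv ((X.extension 2).rel ![α, β] ![α, β]))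
  obtain rfl := ψ.eq_of_toEquiv_rel_self hP.symm
  have hF : ∀ γ, ∃ Q, (X'.extension 2).rel P Q = ψ.toEquiv ((X.extension 2).rel ![α, β] ![α, γ]) := fun γ =>
    (ψ.exists_rel_eq_toEquiv hP.symm ![α, γ]).imp fun _ hQ => hQ.1
  choose F hF using hF
  have huniq : ∀ γ Q, (X'.extension 2).rel P Q = ψ.toEquiv ((X.extension 2).rel ![α, β] ![α, γ]) → Q = F γ := by
    intro γ Q hQ
    obtain ⟨M, hM, hM'⟩ := ψ.exists_rel_eq_of_rel (hF γ).symm Q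
    obtain rfl := eq_of_rel_extension_two_eq (h γ) M (ψ.toEquiv.injective (hM.trans hQ))
    exact ψ.eq_of_toEquiv_rel_self hM'
  have hrel : ∀ γ δ, φ.toEquiv (X.rel γ δ) = X'.rel (F γ 1) (F δ 1) := by
    intro γ δ
    obtain ⟨M, hM, hM'⟩ := ψ.exists_rel_eq_toEquiv (hF δ).symm ![α, γ]
    obtain rfl := huniq γ M hM
    exact AlgebraicIso.rel_apply_eq_of_extension hψ hM'.symm 1
  have hinj : Function.Injective fun γ => F γ 1 := by
    intro γ δ (hγδ : F γ 1 = F δ 1)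
    have := hrel γ δ
    rw [hγδ] at this
    exact φ.eq_of_toEquiv_rel this
  have hbij := hinj.bijective_of_nat_card_le φ.card_eq.ge
  refine ⟨Equiv.ofBijective _ hbij, fun s => Set.Subset.antisymm ?_ ?_⟩
  · rintro _ ⟨⟨γ, δ⟩, hs, rfl⟩
    exact mem_of_rel_eq ((hrel γ δ).symm.trans (congrArg _ (rel_eq hs)))
  · rintro ⟨x, y⟩ hxy
    obtain ⟨γ, rfl⟩ := hbij.2 x
    obtain ⟨δ, rfl⟩ := hbij.2 y
    exact ⟨(γ, δ), mem_of_rel_eq (φ.toEquiv.injective ((hrel γ δ).trans (rel_eq hxy))), rfl⟩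

end Extension

/-! ### Orbits of a group on pairs. -/

section OfAction

variable {G : Type v} {Ω : Type u} [Group G] [Finite Ω] [MulAction G Ω]

theorem ofAction_rel_eq_iff {x y x' y' : Ω} :
    (ofAction G Ω).rel x y = (ofAction G Ω).rel x' y' ↔ ∃ g : G, g • x = x' ∧ g • y = y' := by
  have hrel : ∀ a b : Ω, ((ofAction G Ω).rel a b).1 = MulAction.orbit G (a, b) := by
    intro a b
    exact congrArg Subtype.val (rel_eq (X := ofAction G Ω) (s := ⟨_, (a, b), rfl⟩)
      (MulAction.mem_orbit_self (a, b)))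
  rw [Subtype.ext_iff, hrel, hrel, eq_comm, MulAction.orbit_eq_iff]
  exact ⟨fun ⟨g, hg⟩ => ⟨g, congrArg Prod.fst hg, congrArg Prod.snd hg⟩,
    fun ⟨g, h1, h2⟩ => ⟨g, Prod.ext h1 h2⟩⟩

/-- The stabilizer of a base consisting of at most one point acts trivially. -/
theorem smul_eq_of_isBase {A : Set Ω} {ω : Ω} (hA : A ⊆ {ω}) (h : (ofAction G Ω).IsBase A)
    {g : G} (hg : g • ω = ω) (x : Ω) : g • x = x := by
  -- The orbits of the stabilizer of ω on pairs form a coherent configuration containing all the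
  -- generators, so the point extension is no finer.
  have hsub : ((ofAction G Ω).pointExtension A).relations ⊆
      (ofAction (MulAction.stabilizer G ω) Ω).relations := by
    refine relations_closure_subset ?_
    rintro R (hR | ⟨α, hα, rfl⟩)
    · rw [mem_relations_iff_rel]
      intro a b a' b' hab
      obtain ⟨k, hk, hk'⟩ := ofAction_rel_eq_iff.1 hab
      exact (mem_iff_of_rel_eq (ofAction_rel_eq_iff.2 ⟨(k : G), hk, hk'⟩)
        (basis_subset_relations hR)).1
    · obtain rfl : α = ω := hA hα
      rw [mem_relations_iff_rel]
      intro a b a' b' hab hmem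
      obtain ⟨k, rfl, rfl⟩ := ofAction_rel_eq_iff.1 hab
      obtain ⟨h1, h2⟩ := Prod.ext_iff.1 hmem
      exact Prod.ext ((congrArg (k • ·) h1).trans k.2) ((congrArg (k • ·) h2).trans k.2)
  obtain ⟨p, hp⟩ := h _ (((ofAction G Ω).pointExtension A).rel x x).2
  have hmem := ((ofAction G Ω).pointExtension A).mem_rel x x
  have hxx := hsub (basis_subset_relations (((ofAction G Ω).pointExtension A).rel x x).2)
  have := (mem_iff_of_rel_eq (ofAction_rel_eq_iff.2
    ⟨(⟨g, hg⟩ : MulAction.stabilizer G ω), rfl, rfl⟩) hxx).1 hmem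
  rw [hp] at hmem this
  exact congrArg Prod.fst (this.trans hmem.symm)

end OfAction

end CoherentConfiguration

/-! ### Matrix computations in the Cartan scheme. -/

namespace PSL2

open Matrix CoherentConfiguration

variable {F : Type u} [Field F]

theorem apply_zero_one_eq_zero_and_of_mem_center {z : SpecialLinearGroup (Fin 2) F}
    (hz : z ∈ Subgroup.center (SpecialLinearGroup (Fin 2) F)) : z 0 1 = 0 ∧ z 1 0 = 0 := by
  obtain ⟨r, -, hr⟩ := Matrix.SpecialLinearGroup.mem_center_iff.1 hz
  rw [← hr]
  simp

/-- Central matrices are diagonal, so the zero pattern survives passage to the quotient; an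
antidiagonal representative of an element of B would give a zero first column. Cosets can thus be
handled by matrices in SL. -/
theorem mk_mem_inf_iff {M : SpecialLinearGroup (Fin 2) F} :
    (QuotientGroup.mk M : ProjectiveSpecialLinearGroup (Fin 2) F) ∈ B F ⊓ N F ↔
      M 0 1 = 0 ∧ M 1 0 = 0 := by
  constructor
  · rintro ⟨⟨U, hU, hUM⟩, ⟨V, hV, hVM⟩⟩
    change U 1 0 = 0 at hU
    change (V 0 1 = 0 ∧ V 1 0 = 0) ∨ (V 0 0 = 0 ∧ V 1 1 = 0) at hV
    have hdet := M.det_coe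
    rw [det_fin_two] at hdet
    have hMU : M = U * (U⁻¹ * M) := by group
    have hMV : M = V * (V⁻¹ * M) := by group
    obtain ⟨h1, h2⟩ := apply_zero_one_eq_zero_and_of_mem_center (QuotientGroup.eq.1 hUM)
    obtain ⟨h3, h4⟩ := apply_zero_one_eq_zero_and_of_mem_center (QuotientGroup.eq.1 hVM)
    have h10 : M 1 0 = 0 := by
      rw [hMU, Matrix.SpecialLinearGroup.coe_mul, mul_apply, Fin.sum_univ_two, hU, h2]
      simp
    refine ⟨?_, h10⟩
    rcases hV with ⟨h5, -⟩ | ⟨h5, -⟩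
    · rw [hMV, Matrix.SpecialLinearGroup.coe_mul, mul_apply, Fin.sum_univ_two, h5, h3]
      simp
    · have h00 : M 0 0 = 0 := by
        rw [hMV, Matrix.SpecialLinearGroup.coe_mul, mul_apply, Fin.sum_univ_two, h5, h4]
        simp
      rw [h00, h10] at hdet
      simp at hdet
  · intro h
    exact ⟨⟨M, h.2, rfl⟩, ⟨M, Or.inl h, rfl⟩⟩

/-- The coset of the Cartan subgroup that contains the image of a matrix `M`. -/
def coset (M : SpecialLinearGroup (Fin 2) F) : RightCosets (B F ⊓ N F) :=
  Quotient.mk _ (QuotientGroup.mk M)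

theorem exists_coset_eq (x : RightCosets (B F ⊓ N F)) : ∃ M, coset M = x := by
  obtain ⟨g, rfl⟩ := Quotient.exists_rep x
  obtain ⟨M, rfl⟩ := QuotientGroup.mk_surjective g
  exact ⟨M, rfl⟩

theorem coset_eq_iff {M M' : SpecialLinearGroup (Fin 2) F} :
    coset M = coset M' ↔ (M' * M⁻¹) 0 1 = 0 ∧ (M' * M⁻¹) 1 0 = 0 := by
  refine (Quotient.eq (r := QuotientGroup.rightRel (B F ⊓ N F))).trans ?_
  rw [QuotientGroup.rightRel_apply, ← QuotientGroup.mk_inv,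
    ← QuotientGroup.mk_mul, mk_mem_inf_iff]

theorem op_smul_coset (M g : SpecialLinearGroup (Fin 2) F) :
    MulOpposite.op (QuotientGroup.mk g : ProjectiveSpecialLinearGroup (Fin 2) F) • coset M =
      coset (M * g) := rfl

theorem rel_coset_eq_iff [Finite F] {x y x' y' : SpecialLinearGroup (Fin 2) F} :
    (cartanScheme (B F) (N F)).rel (coset x) (coset y) =
        (cartanScheme (B F) (N F)).rel (coset x') (coset y') ↔
      ∃ g, coset (x * g) = coset x' ∧ coset (y * g) = coset y' := by
  rw [cartanScheme, ofAction_rel_eq_iff]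
  constructor
  · rintro ⟨⟨g⟩, h⟩
    obtain ⟨M, rfl⟩ := QuotientGroup.mk_surjective g
    exact ⟨M, h⟩
  · rintro ⟨M, h⟩
    exact ⟨MulOpposite.op (QuotientGroup.mk M), h⟩

/-- A common right factor cancels in xy⁻¹, and other representatives multiply it on both sides by
diagonal matrices of determinant 1, which scale the two diagonal entries by inverse factors. -/
theorem apply_mul_apply_eq_of_rel_coset_eq [Finite F] {x y x' y' : SpecialLinearGroup (Fin 2) F}
    (h : (cartanScheme (B F) (N F)).rel (coset x) (coset y) =
      (cartanScheme (B F) (N F)).rel (coset x') (coset y')) :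
    (x' * y'⁻¹) 0 0 * (x' * y'⁻¹) 1 1 = (x * y⁻¹) 0 0 * (x * y⁻¹) 1 1 := by
  obtain ⟨g, hx, hy⟩ := rel_coset_eq_iff.1 h
  obtain ⟨c, rfl⟩ : ∃ c, x' = c * (x * g) := ⟨x' * (x * g)⁻¹, by group⟩
  obtain ⟨d, rfl⟩ : ∃ d, y' = d * (y * g) := ⟨y' * (y * g)⁻¹, by group⟩
  rw [coset_eq_iff, mul_inv_cancel_right] at hx hy
  have key : c * (x * g) * (d * (y * g))⁻¹ = c * (x * y⁻¹) * d⁻¹ := by group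
  rw [key]
  generalize x * y⁻¹ = m
  have hc := c.det_coe
  have hd := d.det_coe
  rw [det_fin_two, hx.1] at hc
  rw [det_fin_two, hy.1] at hd
  simp only [Matrix.SpecialLinearGroup.coe_mul, Matrix.SpecialLinearGroup.coe_inv, adjugate_fin_two, mul_apply,
    Fin.sum_univ_two, hx.1, hx.2, hy.1, hy.2, of_apply, cons_val_zero, cons_val_one,
    cons_val', cons_val_fin_one]
  linear_combination (m 0 0 * m 1 1) * (d 0 0 * d 1 1) * hc + (m 0 0 * m 1 1) * hd

/-- The candidates are the cosets of yg with g diagonal. The two products required to vanish are, up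
to sign, the off-diagonal entries of ygy⁻¹, so they say that yg and y lie in one coset. -/
theorem determines_coset [Finite F] {e y : SpecialLinearGroup (Fin 2) F}
    (h : ∀ g : SpecialLinearGroup (Fin 2) F, g 0 1 = 0 → g 1 0 = 0 → g 0 0 * g 1 1 = 1 →
      (y * g * e⁻¹) 0 0 * (y * g * e⁻¹) 1 1 = (y * e⁻¹) 0 0 * (y * e⁻¹) 1 1 →
      y 0 0 * y 0 1 * (g 0 0 - g 1 1) = 0 ∧ y 1 0 * y 1 1 * (g 0 0 - g 1 1) = 0) :
    (cartanScheme (B F) (N F)).Determines (coset 1) (coset e) (coset y) := by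
  intro δ h1 h2
  obtain ⟨x, rfl⟩ := exists_coset_eq δ
  obtain ⟨g, hg, hgx⟩ := rel_coset_eq_iff.1 h1.symm
  rw [← hgx] at h2 ⊢
  rw [one_mul, eq_comm, coset_eq_iff, inv_one, mul_one] at hg
  have hdet := g.det_coe
  rw [det_fin_two, hg.1, zero_mul, sub_zero] at hdet
  obtain ⟨k, hk, hk'⟩ := rel_coset_eq_iff.1 h2
  obtain ⟨h3, h4⟩ := h g hg.1 hg.2 hdet
    (apply_mul_apply_eq_of_rel_coset_eq (rel_coset_eq_iff.2 ⟨k, hk', hk⟩)).symm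
  rw [eq_comm, coset_eq_iff]
  simp only [Matrix.SpecialLinearGroup.coe_mul, Matrix.SpecialLinearGroup.coe_inv,
    adjugate_fin_two, mul_apply, Fin.sum_univ_two, hg.1, hg.2, of_apply, cons_val_zero,
    cons_val_one, cons_val', cons_val_fin_one]
  exact ⟨by linear_combination -h3, by linear_combination h4⟩

/-- The matrix with rows `(1, 1)` and `(0, 1)`. -/
def upperUnipotent (F : Type u) [Field F] : SpecialLinearGroup (Fin 2) F :=
  ⟨!![1, 1; 0, 1], by simp⟩

theorem coe_upperUnipotent :
    ((upperUnipotent F : SpecialLinearGroup (Fin 2) F) : Matrix (Fin 2) (Fin 2) F) = !![1, 1; 0, 1] :=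
  rfl

/-- The matrix with rows `(1, 0)` and `(1, 1)`. -/
def lowerUnipotent (F : Type u) [Field F] : SpecialLinearGroup (Fin 2) F :=
  ⟨!![1, 0; 1, 1], by simp⟩

theorem coe_lowerUnipotent :
    ((lowerUnipotent F : SpecialLinearGroup (Fin 2) F) : Matrix (Fin 2) (Fin 2) F) = !![1, 0; 1, 1] :=
  rfl

theorem sub_eq_zero_of_mul_one_sub_sq {a d c : F} (had : a * d = 1) (hc : c ≠ 0)
    (h : c * (1 - a ^ 2) = 0) : a - d = 0 := by
  have h1 : 1 - a ^ 2 = 0 := (mul_eq_zero.1 h).resolve_left hc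
  linear_combination -d * h1 - a * had

theorem determines_of_first_column [Finite F] {y : SpecialLinearGroup (Fin 2) F}
    (hy : y 0 0 * y 1 0 ≠ 0) :
    (cartanScheme (B F) (N F)).Determines (coset 1) (coset (upperUnipotent F)) (coset y) := by
  refine determines_coset fun g h1 h2 h3 h4 => ?_
  simp only [coe_upperUnipotent, Matrix.SpecialLinearGroup.coe_mul, Matrix.SpecialLinearGroup.coe_inv,
    adjugate_fin_two, mul_apply, Fin.sum_univ_two, h1, h2, of_apply, cons_val_zero, cons_val_one,
    cons_val', cons_val_fin_one] at h4
  -- Here the invariant of yg is y₀₀y₁₁ − y₀₀y₁₀a² with a = g₀₀.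
  rw [sub_eq_zero_of_mul_one_sub_sq h3 hy
    (by linear_combination h4 - y 0 0 * y 1 1 * h3), mul_zero, mul_zero]
  exact ⟨rfl, rfl⟩

theorem determines_of_second_column [Finite F] {y : SpecialLinearGroup (Fin 2) F}
    (hy : y 0 1 * y 1 1 ≠ 0) :
    (cartanScheme (B F) (N F)).Determines (coset 1) (coset (lowerUnipotent F)) (coset y) := by
  refine determines_coset fun g h1 h2 h3 h4 => ?_
  simp only [coe_lowerUnipotent, Matrix.SpecialLinearGroup.coe_mul, Matrix.SpecialLinearGroup.coe_inv,
    adjugate_fin_two, mul_apply, Fin.sum_univ_two, h1, h2, of_apply, cons_val_zero, cons_val_one,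
    cons_val', cons_val_fin_one] at h4
  -- Now the square of g₁₁ appears, in y₀₀y₁₁ − y₀₁y₁₁g₁₁², so the diagonal entries of g swap roles.
  rw [← neg_sub, sub_eq_zero_of_mul_one_sub_sq ((mul_comm _ _).trans h3) hy
    (by linear_combination h4 - y 0 0 * y 1 1 * h3), neg_zero, mul_zero, mul_zero]
  exact ⟨rfl, rfl⟩

theorem reflTransGen_determines [Finite F] (γ : RightCosets (B F ⊓ N F)) :
    Relation.ReflTransGen ((cartanScheme (B F) (N F)).Determines (coset 1))
      (coset (upperUnipotent F)) γ := by
  obtain ⟨y, rfl⟩ := exists_coset_eq γ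
  by_cases h1 : y 0 0 * y 1 0 = 0
  · by_cases h2 : y 0 1 * y 1 1 = 0
    · have hdet := y.det_coe
      rw [det_fin_two] at hdet
      -- A zero in each column makes y monomial. It normalizes the diagonal group, so α alone
      -- determines its coset.
      refine .single (determines_coset fun g _ _ _ _ => ?_)
      rcases mul_eq_zero.1 h1 with h | h <;> rcases mul_eq_zero.1 h2 with h' | h' <;>
        simp [h, h'] at hdet ⊢
    -- The lower unipotent matrix has first column (1, 1), so it is reached from the upper one and
    -- serves as an intermediate point.
    · exact (Relation.ReflTransGen.single (determines_of_first_column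
        (by simp [coe_lowerUnipotent]))).tail (determines_of_second_column h2)
  · exact .single (determines_of_first_column h1)

/-- For t outside {0, 1, −1}, the conjugate x⁻¹ diag(t, 1/t) x fixes Hx but moves Hux: the relevant
off-diagonal entry is 1/t − t. -/
theorem two_le_ncard_of_isBase [Finite F] (hF : 3 < Nat.card F) {A : Set (RightCosets (B F ⊓ N F))}
    (hA : (cartanScheme (B F) (N F)).IsBase A) : 2 ≤ A.ncard := by
  by_contra! hlt
  have : Nonempty (RightCosets (B F ⊓ N F)) := ⟨coset 1⟩
  obtain ⟨ω, hω⟩ := (Set.ncard_le_one_iff_subset_singleton A.toFinite).1 (Nat.le_of_lt_succ hlt)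
  obtain ⟨x, rfl⟩ := exists_coset_eq ω
  obtain ⟨t, ht⟩ : ∃ t : F, t ∉ ({0, 1, -1} : Set F) := by
    by_contra! h
    have h1 : (Set.univ : Set F) ⊆ {0, 1, -1} := fun t _ => h t
    have h2 := Set.ncard_le_ncard h1
    have h3 := Set.ncard_insert_le (0 : F) {1, -1}
    have h4 := Set.ncard_insert_le (1 : F) {-1}
    rw [Set.ncard_singleton] at h4
    rw [Set.ncard_univ] at h2
    omega
  simp only [Set.mem_insert_iff, Set.mem_singleton_iff, not_or] at ht
  let d : SpecialLinearGroup (Fin 2) F := ⟨!![t, 0; 0, t⁻¹], by simp [ht.1]⟩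
  have hfix := smul_eq_of_isBase hω hA
    (g := MulOpposite.op (QuotientGroup.mk (x⁻¹ * d * x))) (by
      rw [op_smul_coset, eq_comm, coset_eq_iff]
      have : x * (x⁻¹ * d * x) * x⁻¹ = d := by group
      simp [this, d]) (coset (upperUnipotent F * x))
  have hd : (d : Matrix (Fin 2) (Fin 2) F) = !![t, 0; 0, t⁻¹] := rfl
  rw [op_smul_coset, eq_comm, coset_eq_iff] at hfix
  have key : upperUnipotent F * x * (x⁻¹ * d * x) * (upperUnipotent F * x)⁻¹ =
    upperUnipotent F * d * (upperUnipotent F)⁻¹ := by group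
  rw [key] at hfix
  have h := hfix.1
  simp only [coe_upperUnipotent, hd, Matrix.SpecialLinearGroup.coe_mul, Matrix.SpecialLinearGroup.coe_inv,
    adjugate_fin_two, mul_apply, Fin.sum_univ_two, of_apply, cons_val_zero, cons_val_one,
    cons_val', cons_val_fin_one] at h
  have htt : t * t⁻¹ = 1 := mul_inv_cancel₀ ht.1
  have h2 : (t - 1) * (t + 1) = 0 := by linear_combination -t * h + htt
  rcases mul_eq_zero.1 h2 with h3 | h3
  · exact ht.2.1 (sub_eq_zero.1 h3)
  · exact ht.2.2 (eq_neg_of_add_eq_zero_left h3)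

theorem coset_one_ne_coset_upperUnipotent :
    (coset 1 : RightCosets (B F ⊓ N F)) ≠ coset (upperUnipotent F) := by
  rw [Ne, coset_eq_iff, inv_one, mul_one]
  simp [coe_upperUnipotent]

end PSL2

theorem theorem1p4 (q : ℕ) (hq : 3 < q) (F : Type u) [Field F] [Finite F] (hF : Nat.card F = q) :
    (cartanScheme (PSL2.B F) (PSL2.N F)).IsSeparable 2 ∧
      (cartanScheme (PSL2.B F) (PSL2.N F)).baseNumber = 2 := by
  refine ⟨CoherentConfiguration.isSeparable_two PSL2.reflTransGen_determines,
    -- The same base gives the upper bound and the nonemptiness needed for the lower one, since the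
    -- infimum of an empty set of naturals is 0.
    le_antisymm (Nat.sInf_le ⟨_, CoherentConfiguration.isBase_pair PSL2.reflTransGen_determines,
      Set.ncard_pair PSL2.coset_one_ne_coset_upperUnipotent⟩) (le_csInf ⟨_, _,
      CoherentConfiguration.isBase_pair PSL2.reflTransGen_determines, rfl⟩ ?_)⟩
  rintro n ⟨A, hA, rfl⟩
  exact PSL2.two_le_ncard_of_isBase (hF ▸ hq) hA
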